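/- Let $d\ge 2$, let $X,Y\subseteq\mathbb R^d$ with $X$ measurable, and let $\mu$ be a probability measure on $X$ that has a density with respect to Lebesgue measure; assume that this density is bounded and is continuous except on a set of Lebesgue measure zero (so that $\mu$ is nonatomic), and that the support of $\mu$ is contained in a convex compact set $A\subseteq X$. Let $n\ge 2$, let $y_1,\dots,y_n\in Y$ be pairwise distinct, and let $\nu$ be a discrete probability distribution on $Y$ that is non-zero exactly at $y_1,\dots,y_n$. Let $1<p<\infty$ and let the ground cost be $$c(x,y)=\Big(\sum_{k=1}^d |x_k-y_k|^p\Big)^{1/p},\qquad x\in X,\ y\in Y.$$ Let $\Pi(\mu,\nu)$ be the set of probability measures on $X\times Y$ with marginals $\mu$ and $\nu$ (transport plans); a plan is called optimal if it minimizes $P(\pi)=\int_{X\times Y} c\,d\pi$ over $\Pi(\mu,\nu)$. For a measurable map $T:X\to Y$ let $\pi_T$ be the image of $\mu$ under $x\mapsto(x,T(x))$. Then: 1. $\mu\big(\{x\in A : c(x,y_i)-c(x,y_j)=k\}\big)=0$ for all $i\ne j$ and all $k\in\mathbb R$. 2. The optimal transport solution exists, is given by a map, and is unique $\mu$-a.e.: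 there is a measurable map $T:X\to Y$ such that $\pi_T$ is an optimal plan, every optimal plan equals $\pi_T$, and every measurable $T':X\to Y$ for which $\pi_{T'}$ is an optimal plan satisfies $T'=T$ $\mu$-a.e. -/

import Mathlib

open MeasureTheory

noncomputable section

/-- The set `Π(μ, ν)` of transport plans: probability measures on the product with
marginals `μ` and `ν`. -/
def transportPlans {X Y : Type*} [MeasurableSpace X] [MeasurableSpace Y]
    (μ : Measure X) (ν : Measure Y) : Set (Measure (X × Y)) :=
  {π | IsProbabilityMeasure π ∧
    (∀ S : Set X, MeasurableSet S → π (S ×ˢ Set.univ) = μ S) ∧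
    (∀ S : Set Y, MeasurableSet S → π (Set.univ ×ˢ S) = ν S)}

/-- The primal cost `P(π) = ∫ c dπ`. -/
def primalCost {X Y : Type*} [MeasurableSpace X] [MeasurableSpace Y]
    (c : X → Y → ℝ) (π : Measure (X × Y)) : ℝ :=
  ∫ z, c z.1 z.2 ∂π

/-- `π` solves the Monge-Kantorovich problem: it is a transport plan of minimal cost among
all transport plans. -/
def IsOptimalPlan {X Y : Type*} [MeasurableSpace X] [MeasurableSpace Y]
    (c : X → Y → ℝ) (μ : Measure X) (ν : Measure Y) (π : Measure (X × Y)) : Prop :=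
  π ∈ transportPlans μ ν ∧ ∀ π' ∈ transportPlans μ ν, primalCost c π ≤ primalCost c π'

/-- The plan `π_T` that moves the mass at `x` to `T x` without splitting it. -/
def planOfMap {X Y : Type*} [MeasurableSpace X] [MeasurableSpace Y]
    (μ : Measure X) (T : X → Y) : Measure (X × Y) :=
  μ.map (fun x => (x, T x))

/-- The `p`-norm ground cost on `ℝ^d`. -/
def pNormCost {d : ℕ} (p : ℝ) (x y : Fin d → ℝ) : ℝ :=
  (∑ k, |x k - y k| ^ p) ^ (1 / p)

/-- Lebesgue measure on a measurable subset of `ℝ^d`. -/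
def lebesgueOn {d : ℕ} (X : Set (Fin d → ℝ)) : Measure X :=
  (volume : Measure (Fin d → ℝ)).comap Subtype.val

/-- The measure on `X` with density `ρ` with respect to Lebesgue measure. -/
def densityMeasure {d : ℕ} {X : Set (Fin d → ℝ)} (ρ : X → ℝ) : Measure X :=
  (lebesgueOn X).withDensity fun x => ENNReal.ofReal (ρ x)

/-- The data of a semi-discrete transport problem in `ℝ^d`, without the ground cost.
Sets `X`, `Y` carry the subspace topology and Borel structure. -/
structure SemiDiscreteProblem (d : ℕ) where
  X : Set (Fin d → ℝ)
  Y : Set (Fin d → ℝ)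
  measurableSet_X : MeasurableSet X
  /-- The probability density of `μ` on `X`. -/
  density : X → ℝ
  density_nonneg : ∀ x, 0 ≤ density x
  density_aemeasurable : AEMeasurable density (lebesgueOn X)
  density_mass : ∫⁻ x, ENNReal.ofReal (density x) ∂(lebesgueOn X) = 1
  density_bounded : ∃ M : ℝ, ∀ x, density x ≤ M
  density_continuous_ae : ∀ᵐ x ∂(lebesgueOn X), ContinuousAt density x
  nonatomic : NullSingletonClass (densityMeasure density)
  A : Set (Fin d → ℝ)
  A_subset : A ⊆ X
  A_convex : Convex ℝ A
  A_compact : IsCompact A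
  support_subset : (densityMeasure density).support ⊆ {x : X | (x : Fin d → ℝ) ∈ A}
  /-- The number of target points. -/
  n : ℕ
  two_le_n : 2 ≤ n
  /-- The target points, pairwise distinct. -/
  y : Fin n → Y
  y_injective : Function.Injective y
  /-- The discrete target distribution, nonzero exactly at the target points. -/
  targetMass : PMF Y
  targetMass_support : targetMass.support = Set.range y

namespace SemiDiscreteProblem

variable {d : ℕ} (S : SemiDiscreteProblem d)

/-- The source measure on `X`. -/
def μ : Measure S.X := densityMeasure S.density

/-- The target measure on `Y`. -/
def ν : Measure S.Y := S.targetMass.toMeasure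

/-- The `p`-norm ground cost on `X × Y`. -/
def cost (p : ℝ) (x : S.X) (y : S.Y) : ℝ := pNormCost p (x : Fin d → ℝ) (y : Fin d → ℝ)

end SemiDiscreteProblem

end

/-! Ties are null because the `ℓ^p` norm is strictly convex for `1 < p < ∞`. Along a line parallel
to `b - a` that misses `a` and `b`, the difference of the distances to `a` and `b` is strictly
increasing (`strictMono_norm_sub_norm_add_smul`). So a tie set, away from the null line through `a`
and `b`, has infinitely many disjoint translates by bounded multiples of `b - a`, and hence measure
zero.

The rest is Kantorovich duality. A maximizer `ψ` of the dual functional exists by compactness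
(`exists_forall_dualValue_le`). Raising one coordinate of `ψ` shows that each Laguerre cell has at
least its target mass; null ties make the cells a partition a.e., so the masses agree
(`exists_laguerre_assignment`). For every plan the cost is a constant plus the integral of the
nonnegative slack `c - φ - Ψ`. The cell map has zero slack, hence is optimal; any optimal plan has
zero slack a.e., and strict minimality inside the cells puts it on the graph of that map. -/

/-! ### Strict convexity of the `ℓ^p` norm. -/

lemma abs_half_add_rpow_le {p : ℝ} (hp : 1 < p) (x y : ℝ) :
    |(1 / 2) * x + (1 / 2) * y| ^ p ≤ (1 / 2) * |x| ^ p + (1 / 2) * |y| ^ p := by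
  have h1 : |(1 / 2) * x + (1 / 2) * y| ≤ (1 / 2) * |x| + (1 / 2) * |y| := by
    refine (abs_add_le _ _).trans_eq ?_
    simp [abs_mul]
  refine (Real.rpow_le_rpow (abs_nonneg _) h1 (by linarith)).trans ?_
  have := (strictConvexOn_rpow hp).convexOn.right (Set.mem_Ici.2 (abs_nonneg x))
    (Set.mem_Ici.2 (abs_nonneg y)) one_half_pos.le one_half_pos.le (add_halves 1)
  simpa [smul_eq_mul] using this

/-- Strict convexity of `t ^ p` on `[0, ∞)` settles the case of distinct absolute values; otherwise
`x = -y ≠ 0` and the midpoint vanishes. -/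
lemma abs_half_add_rpow_lt {p : ℝ} (hp : 1 < p) {x y : ℝ} (hxy : x ≠ y) :
    |(1 / 2) * x + (1 / 2) * y| ^ p < (1 / 2) * |x| ^ p + (1 / 2) * |y| ^ p := by
  by_cases h : |x| = |y|
  · rcases abs_eq_abs.1 h with h | h
    · exact absurd h hxy
    · subst h
      have hy : y ≠ 0 := fun h => hxy (by simp [h])
      have hpos : 0 < |y| ^ p := Real.rpow_pos_of_pos (abs_pos.2 hy) p
      have h0 : (1 / 2) * -y + (1 / 2) * y = 0 := by ring
      rw [h0, abs_neg, abs_zero, Real.zero_rpow (by linarith)]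
      linarith
  · have h1 : |(1 / 2) * x + (1 / 2) * y| ≤ (1 / 2) * |x| + (1 / 2) * |y| := by
      refine (abs_add_le _ _).trans_eq ?_
      simp [abs_mul]
    refine (Real.rpow_le_rpow (abs_nonneg _) h1 (by linarith)).trans_lt ?_
    have := (strictConvexOn_rpow hp).right (Set.mem_Ici.2 (abs_nonneg x))
      (Set.mem_Ici.2 (abs_nonneg y)) h one_half_pos one_half_pos (add_halves 1)
    simpa [smul_eq_mul] using this

/-- The `ℓ^p` norm on a finite product of lines is strictly convex for `1 < p < ∞`. -/
lemma PiLp.strictConvexSpace_real {ι : Type*} [Fintype ι] {q : ENNReal} [Fact (1 ≤ q)]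
    (hq : 1 < q.toReal) : StrictConvexSpace ℝ (PiLp q fun _ : ι => ℝ) := by
  have hq0 : 0 < q.toReal := by linarith
  refine StrictConvexSpace.of_norm_combo_lt_one fun x y hx hy hxy => ?_
  refine ⟨1 / 2, 1 / 2, by norm_num, ?_⟩
  have key : ∀ z : PiLp q fun _ : ι => ℝ, ‖z‖ = (∑ i, |z i| ^ q.toReal) ^ (1 / q.toReal) := by
    intro z
    simpa using PiLp.norm_eq_sum hq0 z
  have hsum : ∀ z : PiLp q fun _ : ι => ℝ, ‖z‖ = 1 → ∑ i, |z i| ^ q.toReal = 1 := by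
    intro z hz
    rw [key, one_div, Real.rpow_inv_eq (Finset.sum_nonneg fun i _ => by positivity) zero_le_one
      hq0.ne', Real.one_rpow] at hz
    exact hz
  obtain ⟨i, hi⟩ : ∃ i, x i ≠ y i := by
    by_contra! h
    exact hxy (PiLp.ext h)
  rw [key]
  refine Real.rpow_lt_one (Finset.sum_nonneg fun i _ => by positivity) ?_ (by positivity)
  calc ∑ i, |((1 / 2 : ℝ) • x + (1 / 2 : ℝ) • y) i| ^ q.toReal
      < ∑ i, ((1 / 2) * |x i| ^ q.toReal + (1 / 2) * |y i| ^ q.toReal) := by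
        refine Finset.sum_lt_sum (fun j _ => ?_) ⟨i, Finset.mem_univ _, ?_⟩
        · simpa only [PiLp.add_apply, PiLp.smul_apply, smul_eq_mul] using
            abs_half_add_rpow_le hq (x j) (y j)
        · simpa only [PiLp.add_apply, PiLp.smul_apply, smul_eq_mul] using
            abs_half_add_rpow_lt hq hi
    _ = 1 := by
        rw [Finset.sum_add_distrib, ← Finset.mul_sum, ← Finset.mul_sum, hsum x hx, hsum y hy]
        norm_num

/-! ### Null level sets of differences of distances. -/

section StrictConvex

variable {E : Type*} [NormedAddCommGroup E] [NormedSpace ℝ E]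

/-- In a strictly convex space the norm is strictly convex along a line that misses the origin. -/
lemma strictConvexOn_norm_add_smul [StrictConvexSpace ℝ E] {w e : E} (he : e ≠ 0)
    (hw : ∀ r : ℝ, w ≠ r • e) : StrictConvexOn ℝ Set.univ fun t : ℝ => ‖w + t • e‖ := by
  refine ⟨convex_univ, fun t _ s _ hts a b ha hb hab => ?_⟩
  have hz : ∀ r : ℝ, w + r • e ≠ 0 := fun r h =>
    hw (-r) (by rw [neg_smul]; exact eq_neg_of_add_eq_zero_left h)
  -- If the two points were on one ray, comparing coefficients would give either `t = s` or `w` as a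
  -- multiple of `e`.
  have hray : ¬ SameRay ℝ (a • (w + t • e)) (b • (w + s • e)) := by
    intro h
    replace h := (h.pos_smul_left (inv_pos.2 ha)).pos_smul_right (inv_pos.2 hb)
    rw [inv_smul_smul₀ ha.ne', inv_smul_smul₀ hb.ne'] at h
    obtain ⟨r₁, r₂, h₁, h₂, h⟩ := h.exists_pos (hz t) (hz s)
    have h' : (r₁ - r₂) • w = (r₂ * s - r₁ * t) • e := by
      rw [← sub_eq_zero] at h ⊢
      rw [← h]
      module
    by_cases hr : r₁ = r₂
    · subst hr
      rw [sub_self, zero_smul, ← mul_sub, eq_comm, smul_eq_zero] at h'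
      rcases h' with h' | h'
      · rcases mul_eq_zero.1 h' with h' | h'
        · exact h₁.ne' h'
        · exact hts (sub_eq_zero.1 h').symm
      · exact he h'
    · refine hw ((r₁ - r₂)⁻¹ * (r₂ * s - r₁ * t)) ?_
      rw [mul_smul, ← h', smul_smul, inv_mul_cancel₀ (sub_ne_zero.2 hr), one_smul]
  have hlt := norm_add_lt_of_not_sameRay hray
  rw [norm_smul, norm_smul, Real.norm_of_nonneg ha.le, Real.norm_of_nonneg hb.le] at hlt
  convert! hlt using 2
  simp only [smul_eq_mul]
  rw [smul_add, smul_add, add_add_add_comm, ← add_smul a b w, hab, one_smul, smul_smul, smul_smul,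
    add_smul]

/-- Unit increments of a strictly convex function are strictly increasing. -/
lemma StrictConvexOn.strictMono_sub_translate {φ : ℝ → ℝ} (hφ : StrictConvexOn ℝ Set.univ φ) :
    StrictMono fun t => φ t - φ (t - 1) := by
  intro t s hts
  have hδ : 0 < 1 + (s - t) := by linarith
  have hne : t - 1 ≠ s := by linarith
  -- Both `t` and `s - 1` are convex combinations of `t - 1` and `s`, with swapped weights; the two
  -- strict inequalities are added.
  have hα : 0 < (s - t) / (1 + (s - t)) := div_pos (by linarith) hδ
  have hβ : 0 < 1 / (1 + (s - t)) := by positivity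
  have e3 : (s - t) / (1 + (s - t)) + 1 / (1 + (s - t)) = 1 := by field_simp; ring
  have h1 := hφ.right (Set.mem_univ (t - 1)) (Set.mem_univ s) hne hα hβ e3
  have h2 := hφ.right (Set.mem_univ (t - 1)) (Set.mem_univ s) hne hβ hα (by rw [add_comm, e3])
  have e1 : (s - t) / (1 + (s - t)) * (t - 1) + 1 / (1 + (s - t)) * s = t := by
    field_simp; ring
  have e2 : 1 / (1 + (s - t)) * (t - 1) + (s - t) / (1 + (s - t)) * s = s - 1 := by
    field_simp; ring
  simp only [smul_eq_mul, e1, e2] at h1 h2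
  have e4 : (s - t) / (1 + (s - t)) * φ (t - 1) + 1 / (1 + (s - t)) * φ s
      + (1 / (1 + (s - t)) * φ (t - 1) + (s - t) / (1 + (s - t)) * φ s) = φ (t - 1) + φ s := by
    linear_combination (φ (t - 1) + φ s) * e3
  show φ t - φ (t - 1) < φ s - φ (s - 1)
  linarith

variable {V : Type*} [NormedAddCommGroup V] [NormedSpace ℝ V]

/-- The difference of the distances to two points is strictly increasing along every line parallel
to, but different from, the line through these points. -/
lemma strictMono_norm_sub_norm_add_smul [StrictConvexSpace ℝ E] {L : V →ₗ[ℝ] E}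
    (hL : Function.Injective L) {a b : V} (hab : a ≠ b) {x : V} (hx : x ∉ line[ℝ, a, b]) :
    StrictMono fun t : ℝ => ‖L (x + t • (b - a) - a)‖ - ‖L (x + t • (b - a) - b)‖ := by
  have he : L (b - a) ≠ 0 := by
    rw [Ne, map_eq_zero_iff L hL, sub_eq_zero]
    exact hab.symm
  have hw : ∀ r : ℝ, L (x - a) ≠ r • L (b - a) := by
    intro r hr
    rw [← map_smul] at hr
    refine hx ?_
    have hxr : x = AffineMap.lineMap a b r := by
      rw [AffineMap.lineMap_apply, vsub_eq_sub, vadd_eq_add, ← hL hr, sub_add_cancel]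
    rw [hxr]
    exact AffineMap.lineMap_mem_affineSpan_pair r a b
  -- Since `x + t • (b - a) - b = (x - a) + (t - 1) • (b - a)`, the difference is a unit increment
  -- of a single convex function.
  convert! (strictConvexOn_norm_add_smul he hw).strictMono_sub_translate using 4 with t t
  · rw [← map_smul, ← map_add]; congr 1; abel
  · rw [← map_smul, ← map_add]; congr 1; module

/-- For a strictly convex norm in dimension at least two, the level sets of the difference of the
distances to two distinct points are Haar null. -/
lemma addHaar_norm_sub_norm_eq_const [StrictConvexSpace ℝ E] [MeasurableSpace V] [BorelSpace V]
    [FiniteDimensional ℝ V] (m : Measure V) [m.IsAddHaarMeasure]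
    (hV : 2 ≤ Module.finrank ℝ V) {L : V →ₗ[ℝ] E} (hL : Function.Injective L) {a b : V}
    (hab : a ≠ b) (k : ℝ) : m {x | ‖L (x - a)‖ - ‖L (x - b)‖ = k} = 0 := by
  have hLc : Continuous L := L.continuous_of_finiteDimensional
  have hline : m (line[ℝ, a, b] : Set V) = 0 := by
    refine Measure.addHaar_affineSubspace m _ fun h => ?_
    have h1 := (collinear_pair ℝ a b).finrank_le_one
    rw [← direction_affineSpan, h, AffineSubspace.direction_top, finrank_top] at h1
    omega
  have hclosed : IsClosed {x | ‖L (x - a)‖ - ‖L (x - b)‖ = k} :=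
    isClosed_eq (by fun_prop) continuous_const
  refine measure_mono_null (Set.subset_sdiff_union _ (line[ℝ, a, b] : Set V))
    (measure_union_null ?_ hline)
  refine Measure.addHaar_eq_zero_of_disjoint_translates m
    (fun n : ℕ => (1 / ((n : ℝ) + 1)) • (b - a)) ?_ ?_
    (hclosed.measurableSet.diff (AffineSubspace.closed_of_finiteDimensional _).measurableSet)
  · exact Metric.isBounded_range_of_tendsto _
      ((tendsto_one_div_add_atTop_nhds_zero_nat (𝕜 := ℝ)).smul_const (b - a))
  · intro i j hij
    simp only [Function.onFun, Set.singleton_add]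
    rw [Set.disjoint_left]
    rintro _ ⟨x, ⟨hx, hxl⟩, rfl⟩ ⟨x', ⟨hx', -⟩, hxx'⟩
    simp only at hxx'
    -- A common point of two translates gives two tie points on one line parallel to `b - a`,
    -- against strict monotonicity.
    have hx'_eq : x' = x + (1 / ((i : ℝ) + 1) - 1 / ((j : ℝ) + 1)) • (b - a) := by
      rw [sub_smul]
      rw [← eq_sub_iff_add_eq'] at hxx'
      rw [hxx']
      abel
    have ht := (strictMono_norm_sub_norm_add_smul hL hab hxl).injective
      (a₁ := 1 / ((i : ℝ) + 1) - 1 / ((j : ℝ) + 1)) (a₂ := 0) (by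
        simp only [zero_smul, add_zero]
        rw [← hx'_eq]
        exact hx'.trans hx.symm)
    rw [sub_eq_zero, one_div, one_div, inv_inj, add_left_inj, Nat.cast_inj] at ht
    exact hij ht

end StrictConvex

/-! ### The `p`-norm cost. -/

lemma pNormCost_eq_norm {d : ℕ} {p : ℝ} (hp : 1 < p) (x y : Fin d → ℝ) :
    pNormCost p x y =
      ‖(WithLp.linearEquiv (ENNReal.ofReal p) ℝ (Fin d → ℝ)).symm (x - y)‖ := by
  have h : (ENNReal.ofReal p).toReal = p := ENNReal.toReal_ofReal (by linarith)
  rw [PiLp.norm_eq_sum (by rw [h]; linarith), h]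
  rfl

lemma volume_pNormCost_sub_eq_const {d : ℕ} (hd : 2 ≤ d) {p : ℝ} (hp : 1 < p)
    {a b : Fin d → ℝ} (hab : a ≠ b) (k : ℝ) :
    volume {x : Fin d → ℝ | pNormCost p x a - pNormCost p x b = k} = 0 := by
  have : Fact (1 ≤ ENNReal.ofReal p) := ⟨by simpa using hp.le⟩
  have : StrictConvexSpace ℝ (PiLp (ENNReal.ofReal p) fun _ : Fin d => ℝ) :=
    PiLp.strictConvexSpace_real (by rwa [ENNReal.toReal_ofReal (by linarith)])
  simp only [pNormCost_eq_norm hp]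
  exact addHaar_norm_sub_norm_eq_const volume (by simpa using hd)
    (L := (WithLp.linearEquiv (ENNReal.ofReal p) ℝ (Fin d → ℝ)).symm.toLinearMap)
    (WithLp.linearEquiv (ENNReal.ofReal p) ℝ (Fin d → ℝ)).symm.injective hab k

lemma continuous_pNormCost {d : ℕ} {p : ℝ} (hp : 1 < p) :
    Continuous fun z : (Fin d → ℝ) × (Fin d → ℝ) => pNormCost p z.1 z.2 := by
  unfold pNormCost
  refine Continuous.rpow_const (continuous_finsetSum _ fun k _ => ?_) fun _ => Or.inr (by positivity)
  exact Continuous.rpow_const (by fun_prop) fun _ => Or.inr (by linarith)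

lemma pNormCost_nonneg {d : ℕ} (p : ℝ) (x y : Fin d → ℝ) : 0 ≤ pNormCost p x y :=
  Real.rpow_nonneg (Finset.sum_nonneg fun _ _ => Real.rpow_nonneg (abs_nonneg _) _) _

/-! ### The semi-discrete dual problem and Laguerre cells. -/

section SemiDiscreteDual

variable {Ω ι : Type*} [Fintype ι] [Nonempty ι]

/-- The `c`-transform of a potential `ψ` on a finite target. -/
noncomputable def cTransform (c : Ω → ι → ℝ) (ψ : ι → ℝ) (x : Ω) : ℝ :=
  Finset.univ.inf' Finset.univ_nonempty fun i => c x i - ψ i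

lemma cTransform_le (c : Ω → ι → ℝ) (ψ : ι → ℝ) (x : Ω) (i : ι) :
    cTransform c ψ x ≤ c x i - ψ i :=
  Finset.inf'_le _ (Finset.mem_univ i)

lemma le_cTransform_iff {c : Ω → ι → ℝ} {ψ : ι → ℝ} {x : Ω} {r : ℝ} :
    r ≤ cTransform c ψ x ↔ ∀ i, r ≤ c x i - ψ i := by
  simp [cTransform, Finset.le_inf'_iff]

lemma exists_cTransform_eq (c : Ω → ι → ℝ) (ψ : ι → ℝ) (x : Ω) :
    ∃ i, cTransform c ψ x = c x i - ψ i := by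
  obtain ⟨i, -, hi⟩ := Finset.exists_mem_eq_inf' (Finset.univ_nonempty (α := ι))
    fun i => c x i - ψ i
  exact ⟨i, hi⟩

lemma cTransform_sub_const (c : Ω → ι → ℝ) (ψ : ι → ℝ) (m : ℝ) (x : Ω) :
    cTransform c (fun i => ψ i - m) x = cTransform c ψ x + m := by
  refine le_antisymm ?_ ?_
  · obtain ⟨i, hi⟩ := exists_cTransform_eq c ψ x
    have := cTransform_le c (fun i => ψ i - m) x i
    linarith
  · refine le_cTransform_iff.2 fun i => ?_
    have := cTransform_le c ψ x i
    linarith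

lemma continuous_cTransform (c : Ω → ι → ℝ) (x : Ω) :
    Continuous fun ψ : ι → ℝ => cTransform c ψ x :=
  Continuous.finset_inf'_apply _ fun i _ => continuous_const.sub (continuous_apply i)

/-- If the costs at `x` lie in `[0, M]` and the potential in `[-R, R]`, then the `c`-transform
is bounded by `M + R`. -/
lemma abs_cTransform_le {c : Ω → ι → ℝ} {ψ : ι → ℝ} {x : Ω} {M R : ℝ}
    (hM : ∀ i, 0 ≤ c x i ∧ c x i ≤ M) (hR : ∀ i, |ψ i| ≤ R) : |cTransform c ψ x| ≤ M + R := by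
  obtain ⟨i, hi⟩ := exists_cTransform_eq c ψ x
  rw [hi]
  have h1 := abs_le.1 (hR i)
  have h2 := hM i
  rw [abs_le]
  constructor <;> linarith

variable [MeasurableSpace Ω]

lemma measurable_cTransform {c : Ω → ι → ℝ} (hc : ∀ i, Measurable fun x => c x i) (ψ : ι → ℝ) :
    Measurable (cTransform c ψ) := by
  have h : cTransform c ψ =
      Finset.univ.inf' Finset.univ_nonempty fun i => fun x => c x i - ψ i := by
    ext x
    simp [cTransform, Finset.inf'_apply]
  rw [h]
  exact Finset.inf'_induction _ _ (fun _ hf _ hg => hf.inf hg) fun i _ => (hc i).sub_const _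

lemma integrable_cTransform {μ : Measure Ω} [IsFiniteMeasure μ] {c : Ω → ι → ℝ}
    (hc : ∀ i, Measurable fun x => c x i) {M : ℝ}
    (hM : ∀ᵐ x ∂μ, ∀ i, 0 ≤ c x i ∧ c x i ≤ M) (ψ : ι → ℝ) :
    Integrable (cTransform c ψ) μ := by
  refine Integrable.of_bound (measurable_cTransform hc ψ).aestronglyMeasurable (M + ‖ψ‖) ?_
  filter_upwards [hM] with x hx
  exact abs_cTransform_le hx fun i => norm_le_pi_norm ψ i

/-- The Kantorovich dual functional for a finite target with masses `w`. -/
noncomputable def dualValue (μ : Measure Ω) (c : Ω → ι → ℝ) (w ψ : ι → ℝ) : ℝ :=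
  ∫ x, cTransform c ψ x ∂μ + ∑ i, ψ i * w i

lemma dualValue_zero_nonneg {μ : Measure Ω} {c : Ω → ι → ℝ} {M : ℝ} {w : ι → ℝ}
    (hM : ∀ᵐ x ∂μ, ∀ i, 0 ≤ c x i ∧ c x i ≤ M) :
    0 ≤ dualValue μ c w 0 := by
  have h : 0 ≤ ∫ x, cTransform c (0 : ι → ℝ) x ∂μ := by
    refine integral_nonneg_of_ae ?_
    filter_upwards [hM] with x hx
    exact le_cTransform_iff.2 fun i => by simpa using (hx i).1
  simpa [dualValue] using h

section Probability

variable {μ : Measure Ω} [IsProbabilityMeasure μ] {c : Ω → ι → ℝ} {M : ℝ} {w : ι → ℝ}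

lemma dualValue_sub_const (hc : ∀ i, Measurable fun x => c x i)
    (hM : ∀ᵐ x ∂μ, ∀ i, 0 ≤ c x i ∧ c x i ≤ M) (hw1 : ∑ i, w i = 1) (ψ : ι → ℝ) (m : ℝ) :
    dualValue μ c w (fun i => ψ i - m) = dualValue μ c w ψ := by
  unfold dualValue
  simp only [cTransform_sub_const]
  rw [integral_add (integrable_cTransform hc hM ψ) (integrable_const m)]
  simp only [sub_mul, Finset.sum_sub_distrib, ← Finset.mul_sum, hw1]
  simp

/-- The dual functional is bounded by `M` minus the weighted sum of the deficits of the potential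
against its value at any one point. -/
lemma dualValue_le (hc : ∀ i, Measurable fun x => c x i)
    (hM : ∀ᵐ x ∂μ, ∀ i, 0 ≤ c x i ∧ c x i ≤ M) (ψ : ι → ℝ) (i : ι) :
    dualValue μ c w ψ ≤ M - ψ i + ∑ j, ψ j * w j := by
  unfold dualValue
  gcongr
  have h := integral_mono_ae (integrable_cTransform hc hM ψ) (integrable_const (M - ψ i)) (by
    filter_upwards [hM] with x hx
    have := cTransform_le c ψ x i
    have := (hx i).2
    linarith)
  simpa using h

lemma continuousOn_dualValue (hc : ∀ i, Measurable fun x => c x i)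
    (hM : ∀ᵐ x ∂μ, ∀ i, 0 ≤ c x i ∧ c x i ≤ M) (R : ℝ) :
    ContinuousOn (dualValue μ c w) (Set.Icc (fun _ => -R) 0) := by
  refine ContinuousOn.add ?_ (by fun_prop)
  refine continuousOn_of_dominated (bound := fun _ => M + R)
    (fun ψ _ => (measurable_cTransform hc ψ).aestronglyMeasurable) (fun ψ hψ => ?_)
    (integrable_const _) (.of_forall fun x => (continuous_cTransform c x).continuousOn)
  filter_upwards [hM] with x hx
  refine abs_cTransform_le hx fun i => ?_
  have h1 := hψ.1 i
  have h2 := hψ.2 i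
  simp only [Pi.zero_apply] at h1 h2
  rw [abs_le]
  constructor <;> linarith

/-- The dual problem of semi-discrete optimal transport has a solution. -/
lemma exists_forall_dualValue_le (hc : ∀ i, Measurable fun x => c x i)
    (hM : ∀ᵐ x ∂μ, ∀ i, 0 ≤ c x i ∧ c x i ≤ M) (hw : ∀ i, 0 < w i) (hw1 : ∑ i, w i = 1) :
    ∃ ψ, ∀ ψ', dualValue μ c w ψ' ≤ dualValue μ c w ψ := by
  obtain ⟨i₀, hi₀⟩ := Finite.exists_min w
  have hM0 : 0 ≤ M := by
    obtain ⟨x, hx⟩ := hM.exists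
    exact (hx i₀).1.trans (hx i₀).2
  have hR : 0 ≤ M / w i₀ := div_nonneg hM0 (hw i₀).le
  have h0 : (0 : ι → ℝ) ∈ Set.Icc (fun _ => -(M / w i₀)) (0 : ι → ℝ) :=
    ⟨fun i => by simpa using hR, le_rfl⟩
  obtain ⟨ψ, -, hψ⟩ := isCompact_Icc.exists_isMaxOn ⟨0, h0⟩
    (continuousOn_dualValue (w := w) hc hM (M / w i₀))
  refine ⟨ψ, fun ψ' => ?_⟩
  by_contra! hlt
  have hpos : 0 ≤ dualValue μ c w ψ' :=
    (dualValue_zero_nonneg hM).trans ((hψ h0).trans hlt.le)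
  -- Shift the better competitor to have maximum zero. Its value is nonnegative, so `dualValue_le`
  -- at `i₁` bounds its weighted deficits by `M`, and each deficit by `M` over the least weight: it
  -- lies in the box.
  obtain ⟨i₁, hi₁⟩ := Finite.exists_max ψ'
  refine absurd (hψ (a := fun i => ψ' i - ψ' i₁) ⟨fun i => ?_, fun i => ?_⟩) ?_
  · have hle := hpos.trans (dualValue_le (w := w) hc hM ψ' i₁)
    have hsum : ∑ j, (ψ' i₁ - ψ' j) * w j = ψ' i₁ - ∑ j, ψ' j * w j := by
      simp only [sub_mul, Finset.sum_sub_distrib, ← Finset.mul_sum, hw1, mul_one]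
    have hterm : (ψ' i₁ - ψ' i) * w i ≤ ∑ j, (ψ' i₁ - ψ' j) * w j :=
      Finset.single_le_sum (f := fun j => (ψ' i₁ - ψ' j) * w j)
        (fun j _ => mul_nonneg (sub_nonneg.2 (hi₁ j)) (hw j).le) (Finset.mem_univ i)
    have hmin : (ψ' i₁ - ψ' i) * w i₀ ≤ (ψ' i₁ - ψ' i) * w i :=
      mul_le_mul_of_nonneg_left (hi₀ i) (sub_nonneg.2 (hi₁ i))
    have : ψ' i₁ - ψ' i ≤ M / w i₀ := (le_div_iff₀ (hw i₀)).2 (by linarith)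
    simp only
    linarith
  · simpa using hi₁ i
  · simp only [Set.mem_ofPred_eq, not_le]
    rwa [dualValue_sub_const hc hM hw1]

/-- First-order optimality: each relaxed Laguerre cell of an optimal potential carries at least the
target mass. -/
lemma le_measureReal_relaxed_cell (hc : ∀ i, Measurable fun x => c x i)
    (hM : ∀ᵐ x ∂μ, ∀ i, 0 ≤ c x i ∧ c x i ≤ M) {ψ : ι → ℝ}
    (hψ : ∀ ψ', dualValue μ c w ψ' ≤ dualValue μ c w ψ) (i : ι) {t : ℝ} (ht : 0 < t) :
    w i ≤ μ.real {x | ∀ j, c x i - ψ i - t ≤ c x j - ψ j} := by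
  classical
  set C : Set Ω := {x | ∀ j, c x i - ψ i - t ≤ c x j - ψ j} with hC
  have hCm : MeasurableSet C := by
    rw [hC, Set.ofPred_forall]
    exact MeasurableSet.iInter fun j => measurableSet_le (((hc i).sub_const _).sub_const _)
      ((hc j).sub_const _)
  -- Raising coordinate `i` by `t` lowers the `c`-transform by at most `t`, and only on `C`:
  -- elsewhere another index still beats `i`.
  set ψ' : ι → ℝ := fun j => ψ j + if j = i then t else 0 with hψ'
  have hpt : ∀ x, cTransform c ψ x - C.indicator (fun _ => t) x ≤ cTransform c ψ' x := by
    intro x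
    refine le_cTransform_iff.2 fun j => ?_
    have hj := cTransform_le c ψ x j
    by_cases hx : x ∈ C
    · rw [Set.indicator_of_mem hx, hψ']
      simp only
      split_ifs <;> linarith
    · rw [Set.indicator_of_notMem hx, hψ']
      simp only
      split_ifs with hji
      · subst hji
        simp only [hC, Set.mem_ofPred_eq, not_forall, not_le] at hx
        obtain ⟨l, hl⟩ := hx
        have := cTransform_le c ψ x l
        linarith
      · linarith
  have hint := integrable_cTransform hc hM ψ
  have hind : Integrable (C.indicator fun _ => t) μ := (integrable_const t).indicator hCm
  have h1 := integral_mono (hint.sub hind) (integrable_cTransform hc hM ψ') hpt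
  simp only [Pi.sub_apply] at h1
  rw [integral_sub hint hind, integral_indicator_const t hCm, smul_eq_mul] at h1
  have h2 := hψ ψ'
  unfold dualValue at h2
  have h3 : ∑ j, ψ' j * w j = ∑ j, ψ j * w j + t * w i := by
    simp [hψ', add_mul, Finset.sum_add_distrib]
  rw [h3] at h2
  have h4 : w i * t ≤ μ.real C * t := by linarith
  exact le_of_mul_le_mul_right h4 ht

/-- The relaxed cells with `t = 1 / (n + 1)` decrease to the cell, so continuity from above applies.
-/
lemma le_measureReal_cell (hc : ∀ i, Measurable fun x => c x i)
    (hM : ∀ᵐ x ∂μ, ∀ i, 0 ≤ c x i ∧ c x i ≤ M) {ψ : ι → ℝ}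
    (hψ : ∀ ψ', dualValue μ c w ψ' ≤ dualValue μ c w ψ) (i : ι) :
    w i ≤ μ.real {x | ∀ j, c x i - ψ i ≤ c x j - ψ j} := by
  set C : ℕ → Set Ω := fun n => {x | ∀ j, c x i - ψ i - 1 / ((n : ℝ) + 1) ≤ c x j - ψ j} with hC
  have hCm : ∀ n, MeasurableSet (C n) := fun n => by
    simp only [hC, Set.ofPred_forall]
    exact MeasurableSet.iInter fun j => measurableSet_le (((hc i).sub_const _).sub_const _)
      ((hc j).sub_const _)
  have hanti : Antitone C := by
    intro m n hmn x hx j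
    have h1 := hx j
    have h2 : 1 / ((n : ℝ) + 1) ≤ 1 / ((m : ℝ) + 1) := Nat.one_div_le_one_div hmn
    linarith
  have hInter : ⋂ n, C n = {x | ∀ j, c x i - ψ i ≤ c x j - ψ j} := by
    ext x
    simp only [hC, Set.mem_iInter, Set.mem_ofPred_eq]
    constructor
    · intro h j
      have hlim : Filter.Tendsto (fun n : ℕ => c x i - ψ i - 1 / ((n : ℝ) + 1)) Filter.atTop
          (nhds (c x i - ψ i - 0)) :=
        tendsto_const_nhds.sub tendsto_one_div_add_atTop_nhds_zero_nat
      rw [sub_zero] at hlim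
      exact le_of_tendsto' hlim fun n => h n j
    · intro h n j
      have : 0 < 1 / ((n : ℝ) + 1) := Nat.one_div_pos_of_nat
      linarith [h j]
  have hlim := tendsto_measure_iInter_atTop (μ := μ) (fun n => (hCm n).nullMeasurableSet) hanti
    ⟨0, measure_ne_top _ _⟩
  rw [hInter] at hlim
  exact ge_of_tendsto' ((ENNReal.tendsto_toReal (measure_ne_top _ _)).comp hlim) fun n =>
    le_measureReal_relaxed_cell hc hM hψ i Nat.one_div_pos_of_nat

/-- If ties between costs are null, then there is a potential whose Laguerre cells partition the
source up to a null set and have the prescribed masses; `τ x` is the index of the cell of `x`. -/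
lemma exists_laguerre_assignment (hc : ∀ i, Measurable fun x => c x i)
    (hM : ∀ᵐ x ∂μ, ∀ i, 0 ≤ c x i ∧ c x i ≤ M)
    (htie : ∀ i j, i ≠ j → ∀ k : ℝ, μ {x | c x i - c x j = k} = 0)
    (hw : ∀ i, 0 < w i) (hw1 : ∑ i, w i = 1) [MeasurableSpace ι] [MeasurableSingletonClass ι] :
    ∃ (ψ : ι → ℝ) (τ : Ω → ι), Measurable τ ∧
      (∀ᵐ x ∂μ, ∀ j, j ≠ τ x → c x (τ x) - ψ (τ x) < c x j - ψ j) ∧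
      ∀ i, μ.real (τ ⁻¹' {i}) = w i := by
  classical
  obtain ⟨ψ, hψ⟩ := exists_forall_dualValue_le hc hM hw hw1
  set C : ι → Set Ω := fun i => {x | ∀ j, c x i - ψ i ≤ c x j - ψ j} with hC
  -- Strict cells are pairwise disjoint, and agree with the closed cells `C` off the null ties.
  set D : ι → Set Ω := fun i => {x | ∀ j, j ≠ i → c x i - ψ i < c x j - ψ j} with hD
  have hDm : ∀ i, MeasurableSet (D i) := fun i => by
    simp only [hD, Set.ofPred_forall]
    exact MeasurableSet.iInter fun j => MeasurableSet.iInter fun _ =>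
      measurableSet_lt ((hc i).sub_const _) ((hc j).sub_const _)
  have hnotie : ∀ᵐ x ∂μ, ∀ i j, i ≠ j → c x i - ψ i ≠ c x j - ψ j := by
    rw [ae_all_iff]
    intro i
    rw [ae_all_iff]
    intro j
    by_cases hij : i = j
    · simp [hij]
    · refine measure_mono_null (fun x hx => ?_) (htie i j hij (ψ i - ψ j))
      simp only [Set.mem_compl_iff, Set.mem_ofPred_eq, not_forall, not_not] at hx ⊢
      obtain ⟨-, hx⟩ := hx
      linarith
  have hD_unique : ∀ x i j, x ∈ D i → x ∈ D j → i = j := by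
    intro x i j hi hj
    by_contra hij
    exact lt_asymm (hi j (Ne.symm hij)) (hj i hij)
  have hCD : ∀ᵐ x ∂μ, ∀ i, x ∈ C i ↔ x ∈ D i := by
    filter_upwards [hnotie] with x hx i
    refine ⟨fun h j hj => lt_of_le_of_ne (h j) (hx i j hj.symm), fun h j => ?_⟩
    by_cases hj : j = i
    · rw [hj]
    · exact (h j hj).le
  have hcover : ∀ᵐ x ∂μ, ∃ i, x ∈ D i := by
    filter_upwards [hCD] with x hx
    obtain ⟨i, hi⟩ := exists_cTransform_eq c ψ x
    exact ⟨i, (hx i).1 fun j => hi ▸ cTransform_le c ψ x j⟩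
  set U : Set Ω := {x | ∃ i, x ∈ D i} with hU
  have hUm : MeasurableSet U := by
    rw [hU, Set.ofPred_exists]
    exact MeasurableSet.iUnion hDm
  -- The default index is used only off `U`, a null set.
  set τ : Ω → ι := fun x => if h : ∃ i, x ∈ D i then h.choose else Classical.arbitrary ι with hτ
  have hτD : ∀ x ∈ U, x ∈ D (τ x) := by
    intro x hx
    have hx' : ∃ i, x ∈ D i := hx
    simp only [hτ, dif_pos hx']
    exact hx'.choose_spec
  have hpre : ∀ i, τ ⁻¹' {i} = D i ∪ (Uᶜ ∩ {_x | Classical.arbitrary ι = i}) := by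
    intro i
    ext x
    by_cases hx : x ∈ U
    · have : x ∈ Uᶜ ↔ False := by simp [hx]
      simp only [Set.mem_preimage, Set.mem_singleton_iff, Set.mem_union, Set.mem_inter_iff, this,
        false_and, or_false]
      exact ⟨fun h => h ▸ hτD x hx, fun h => hD_unique x _ _ (hτD x hx) h⟩
    · have h1 : τ x = Classical.arbitrary ι := dif_neg hx
      have h2 : x ∉ D i := fun h => hx ⟨i, h⟩
      simp [h1, h2, hx]
  have hτm : Measurable τ := by
    refine measurable_to_countable' fun i => ?_
    rw [hpre]
    exact (hDm i).union (hUm.compl.inter (MeasurableSet.const _))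
  have hle : ∀ i, w i ≤ μ.real (τ ⁻¹' {i}) := by
    intro i
    refine (le_measureReal_cell hc hM hψ i).trans ?_
    refine ENNReal.toReal_mono (measure_ne_top _ _) (measure_mono_ae ?_)
    filter_upwards [hCD] with x hx hxi
    have hxD : x ∈ D i := (hx i).1 hxi
    exact hD_unique x _ _ (hτD x ⟨i, hxD⟩) hxD
  have hsum : ∑ i, μ.real (τ ⁻¹' {i}) = 1 := by
    have h := sum_measureReal_preimage_singleton (μ := μ) (f := τ) Finset.univ
      (fun i _ => hτm (measurableSet_singleton i))
    simpa using h
  refine ⟨ψ, τ, hτm, ?_, fun i => ?_⟩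
  · filter_upwards [hcover] with x hx
    exact hτD x hx
  -- Termwise inequalities between two families of total `1` are equalities.
  · have h := (Finset.sum_eq_sum_iff_of_le (s := Finset.univ) fun i _ => hle i).1
      (hw1.trans hsum.symm)
    exact (h i (Finset.mem_univ i)).symm

end Probability

end SemiDiscreteDual

/-! ### Marginals and plans induced by maps. -/

section Plans

variable {X Y : Type*} [MeasurableSpace X] [MeasurableSpace Y] {μ : Measure X} {ν : Measure Y}
  {π : Measure (X × Y)}

lemma map_fst_of_mem_transportPlans (hπ : π ∈ transportPlans μ ν) : π.map Prod.fst = μ := by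
  ext s hs
  rw [Measure.map_apply measurable_fst hs, ← hπ.2.1 s hs, Set.prod_univ]

lemma map_snd_of_mem_transportPlans (hπ : π ∈ transportPlans μ ν) : π.map Prod.snd = ν := by
  ext s hs
  rw [Measure.map_apply measurable_snd hs, ← hπ.2.2 s hs, Set.univ_prod]

lemma planOfMap_mem_transportPlans [IsProbabilityMeasure μ] {T : X → Y} (hT : Measurable T)
    (hmap : μ.map T = ν) : planOfMap μ T ∈ transportPlans μ ν := by
  have hm : Measurable fun x => (x, T x) := measurable_id.prodMk hT
  refine ⟨Measure.isProbabilityMeasure_map hm.aemeasurable, fun s hs => ?_, fun s hs => ?_⟩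
  · rw [planOfMap, Measure.map_apply hm (hs.prod .univ)]
    congr 1
    ext x
    simp
  · rw [planOfMap, Measure.map_apply hm (MeasurableSet.univ.prod hs), ← hmap,
      Measure.map_apply hT hs]
    congr 1
    ext x
    simp

/-- A plan concentrated on the graph of a measurable map is the plan of that map. -/
lemma eq_planOfMap_of_ae_eq (hπ : π ∈ transportPlans μ ν) {T : X → Y} (hT : Measurable T)
    (h : ∀ᵐ z ∂π, z.2 = T z.1) : π = planOfMap μ T := by
  have hm : Measurable fun x => (x, T x) := measurable_id.prodMk hT
  calc π = π.map id := Measure.map_id.symm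
    _ = π.map ((fun x => (x, T x)) ∘ Prod.fst) := by
        refine Measure.map_congr ?_
        filter_upwards [h] with z hz
        exact Prod.ext rfl hz
    _ = planOfMap μ T := by
        rw [← Measure.map_map hm measurable_fst, map_fst_of_mem_transportPlans hπ, planOfMap]

variable [MeasurableSingletonClass Y] {ι : Type*} [Finite ι] {y : ι → Y}

/-- Two measures carried by a finite set agree if they agree on its points. -/
lemma MeasureTheory.Measure.ext_of_finite_range {ν' : Measure Y} (hν : ν (Set.range y)ᶜ = 0)
    (hν' : ν' (Set.range y)ᶜ = 0) (h : ∀ i, ν {y i} = ν' {y i}) : ν = ν' := by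
  ext s -
  have hcount : (s ∩ Set.range y).Countable := (Set.finite_range y).countable.mono
    Set.inter_subset_right
  have key : ∀ m : Measure Y, m (Set.range y)ᶜ = 0 → m s = ∑' z : ↥(s ∩ Set.range y), m {z.1} := by
    intro m hm
    have hdiff : m (s \ Set.range y) = 0 := measure_mono_null (fun z hz => hz.2) hm
    rw [← measure_inter_add_sdiff₀ (μ := m) s (Set.finite_range y).measurableSet.nullMeasurableSet,
      hdiff, add_zero]
    conv_lhs => rw [← Set.biUnion_of_singleton (s ∩ Set.range y)]
    exact measure_biUnion hcount (fun a _ b _ hab => by simpa using hab)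
      fun a _ => measurableSet_singleton a
  rw [key ν hν, key ν' hν']
  refine tsum_congr fun z => ?_
  obtain ⟨i, hi⟩ := z.2.2
  rw [← hi, h i]

end Plans

/-! ### Optimality and uniqueness through complementary slackness. -/

/-- Existence and uniqueness of optimal plans, and their representation by a map, in semi-discrete
optimal transport with null ties between the costs of any two target points. -/
theorem exists_unique_optimal_map {X Y ι : Type*} [MeasurableSpace X] [MeasurableSpace Y]
    [MeasurableSingletonClass Y] [Fintype ι] [Nonempty ι] {μ : Measure X} [IsProbabilityMeasure μ]
    {ν : Measure Y} [IsProbabilityMeasure ν] {c : X → Y → ℝ}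
    (hc : Measurable fun z : X × Y => c z.1 z.2) {y : ι → Y} (hy : Function.Injective y)
    (hν : ν (Set.range y)ᶜ = 0) (hνpos : ∀ i, ν {y i} ≠ 0) {M : ℝ}
    (hM : ∀ᵐ x ∂μ, ∀ i, 0 ≤ c x (y i) ∧ c x (y i) ≤ M)
    (htie : ∀ i j, i ≠ j → ∀ k : ℝ, μ {x | c x (y i) - c x (y j) = k} = 0) :
    ∃ T : X → Y, Measurable T ∧ IsOptimalPlan c μ ν (planOfMap μ T) ∧
      (∀ π : Measure (X × Y), IsOptimalPlan c μ ν π → π = planOfMap μ T) ∧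
      (∀ T' : X → Y, Measurable T' → IsOptimalPlan c μ ν (planOfMap μ T') → T' =ᵐ[μ] T) := by
  classical
  let _ : MeasurableSpace ι := ⊤
  have : MeasurableSingletonClass ι := ⟨fun _ => trivial⟩
  have hci : ∀ i, Measurable fun x => c x (y i) := fun i =>
    hc.comp (measurable_id.prodMk measurable_const)
  have hw1 : ∑ i, ν.real {y i} = 1 := by
    have h1 : ν.real (Finset.univ.image y : Finset Y) = 1 := by
      have h2 : ν (Finset.univ.image y : Finset Y) = 1 := by
        rw [Finset.coe_image, Finset.coe_univ, Set.image_univ]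
        exact (prob_compl_eq_zero_iff (Set.finite_range y).measurableSet).1 hν
      rw [Measure.real, h2, ENNReal.toReal_one]
    rw [← sum_measureReal_singleton, Finset.sum_image fun i _ j _ h => hy h] at h1
    exact h1
  obtain ⟨ψ, τ, hτm, hτ, hτmass⟩ := exists_laguerre_assignment (c := fun x i => c x (y i)) hci hM
    htie (fun i => ENNReal.toReal_pos (hνpos i) (measure_ne_top _ _)) hw1
  set T : X → Y := fun x => y (τ x) with hT
  have hTm : Measurable T := (measurable_of_countable y).comp hτm
  have hmap : μ.map T = ν := by
    refine Measure.ext_of_finite_range (y := y) ?_ hν fun i => ?_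
    · rw [Measure.map_apply hTm (Set.finite_range y).measurableSet.compl]
      convert! measure_empty (μ := μ)
      ext x
      simp [hT]
    · rw [Measure.map_apply hTm (measurableSet_singleton _)]
      have hpre : T ⁻¹' {y i} = τ ⁻¹' {i} := by
        ext x
        simp [hT, hy.eq_iff]
      rw [hpre]
      exact (measureReal_eq_measureReal_iff).1 (hτmass i)
  have hTplan := planOfMap_mem_transportPlans hTm hmap
  set φ : X → ℝ := cTransform (fun x i => c x (y i)) ψ with hφ
  have hφint : Integrable φ μ := integrable_cTransform hci hM ψ
  -- The potential `ψ` carried to `Y`, zero off the target points.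
  set Ψ : Y → ℝ := fun z => ∑ i, ({y i} : Set Y).indicator (fun _ => ψ i) z with hΨ
  have hΨy : ∀ i, Ψ (y i) = ψ i := by
    intro i
    simp only [hΨ]
    rw [Finset.sum_eq_single i]
    · simp
    · intro j _ hj
      simp [hy.eq_iff, hj.symm]
    · simp
  have hΨint : Integrable Ψ ν :=
    integrable_finsetSum _ fun i _ => (integrable_const _).indicator (measurableSet_singleton _)
  set slack : X × Y → ℝ := fun z => c z.1 z.2 - (φ z.1 + Ψ z.2) with hslack
  have hae : ∀ π ∈ transportPlans μ ν, ∀ᵐ z ∂π, (∃ i, z.2 = y i) ∧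
      (∀ i, 0 ≤ c z.1 (y i) ∧ c z.1 (y i) ≤ M) ∧
      ∀ j, j ≠ τ z.1 → c z.1 (y (τ z.1)) - ψ (τ z.1) < c z.1 (y j) - ψ j := by
    intro π hπ
    have h1 : ∀ᵐ z ∂π, z.2 ∈ Set.range y :=
      ae_of_ae_map measurable_snd.aemeasurable (p := fun b => b ∈ Set.range y)
        (by rw [map_snd_of_mem_transportPlans hπ]; exact hν)
    have hfst : ∀ {q : X → Prop}, (∀ᵐ x ∂μ, q x) → ∀ᵐ z ∂π, q z.1 := fun hq =>
      ae_of_ae_map measurable_fst.aemeasurable (by rwa [map_fst_of_mem_transportPlans hπ])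
    filter_upwards [h1, hfst hM, hfst hτ] with z hz1 hz2 hz3
    obtain ⟨i, hi⟩ := hz1
    exact ⟨⟨i, hi.symm⟩, hz2, hz3⟩
  have hcint : ∀ π ∈ transportPlans μ ν, Integrable (fun z => c z.1 z.2) π := by
    intro π hπ
    have := hπ.1
    refine Integrable.of_bound hc.aestronglyMeasurable M ?_
    filter_upwards [hae π hπ] with z ⟨⟨i, hi⟩, hz, _⟩
    rw [hi, Real.norm_of_nonneg (hz i).1]
    exact (hz i).2
  have hφπ : ∀ π ∈ transportPlans μ ν, Integrable (fun z => φ z.1) π ∧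
      ∫ z, φ z.1 ∂π = ∫ x, φ x ∂μ := by
    intro π hπ
    have hμ := map_fst_of_mem_transportPlans hπ
    rw [← hμ] at hφint
    exact ⟨hφint.comp_measurable measurable_fst, by
      rw [← integral_map measurable_fst.aemeasurable hφint.1, hμ]⟩
  have hΨπ : ∀ π ∈ transportPlans μ ν, Integrable (fun z => Ψ z.2) π ∧
      ∫ z, Ψ z.2 ∂π = ∫ b, Ψ b ∂ν := by
    intro π hπ
    have hν := map_snd_of_mem_transportPlans hπ
    rw [← hν] at hΨint
    exact ⟨hΨint.comp_measurable measurable_snd, by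
      rw [← integral_map measurable_snd.aemeasurable hΨint.1, hν]⟩
  have hslackint : ∀ π ∈ transportPlans μ ν, Integrable slack π := fun π hπ =>
    (hcint π hπ).sub ((hφπ π hπ).1.add (hΨπ π hπ).1)
  have hcost : ∀ π ∈ transportPlans μ ν,
      primalCost c π = ∫ z, slack z ∂π + (∫ x, φ x ∂μ + ∫ b, Ψ b ∂ν) := by
    intro π hπ
    have hadd : Integrable (fun z => φ z.1 + Ψ z.2) π := (hφπ π hπ).1.add (hΨπ π hπ).1
    simp only [hslack]
    rw [integral_sub (hcint π hπ) hadd, integral_add (hφπ π hπ).1 (hΨπ π hπ).1, (hφπ π hπ).2, (hΨπ π hπ).2, primalCost]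
    ring
  have hnonneg : ∀ π ∈ transportPlans μ ν, 0 ≤ᵐ[π] slack := by
    intro π hπ
    filter_upwards [hae π hπ] with z ⟨⟨i, hi⟩, _, _⟩
    have := cTransform_le (fun x i => c x (y i)) ψ z.1 i
    simp only [hslack, hi, hΨy, Pi.zero_apply, hφ]
    linarith
  have hTzero : ∫ z, slack z ∂(planOfMap μ T) = 0 := by
    have hm : Measurable fun x => (x, T x) := measurable_id.prodMk hTm
    rw [planOfMap, integral_map hm.aemeasurable (hslackint _ hTplan).1]
    refine integral_eq_zero_of_ae ?_
    filter_upwards [hτ] with x hx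
    have h1 : φ x = c x (y (τ x)) - ψ (τ x) := by
      refine le_antisymm (cTransform_le _ _ _ _) (le_cTransform_iff.2 fun j => ?_)
      by_cases hj : j = τ x
      · rw [hj]
      · exact (hx j hj).le
    simp only [hslack, hT, hΨy, h1, Pi.zero_apply]
    ring
  have hgraph : ∀ π, IsOptimalPlan c μ ν π → ∀ᵐ z ∂π, z.2 = T z.1 := by
    intro π hπ
    have h1 := hπ.2 _ hTplan
    rw [hcost _ hTplan, hcost _ hπ.1, hTzero] at h1
    have h2 : ∫ z, slack z ∂π = 0 :=
      le_antisymm (by linarith) (integral_nonneg_of_ae (hnonneg π hπ.1))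
    rw [integral_eq_zero_iff_of_nonneg_ae (hnonneg π hπ.1) (hslackint π hπ.1)] at h2
    -- Zero slack at `y i` means that `i` attains the `c`-transform, which only `τ z.1` does.
    filter_upwards [h2, hae π hπ.1] with z hz ⟨⟨i, hi⟩, _, hz'⟩
    rw [hi]
    by_contra hne
    have hne' : i ≠ τ z.1 := fun h => hne (by rw [h])
    have h3 := hz' i hne'
    have h4 := cTransform_le (fun x i => c x (y i)) ψ z.1 (τ z.1)
    simp only [hslack, hi, hΨy, Pi.zero_apply, hφ] at hz
    linarith
  refine ⟨T, hTm, ⟨hTplan, fun π hπ => ?_⟩, fun π hπ => ?_, fun T' hT' hopt => ?_⟩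
  · rw [hcost _ hTplan, hcost _ hπ, hTzero]
    have := integral_nonneg_of_ae (hnonneg π hπ)
    linarith
  · exact eq_planOfMap_of_ae_eq hπ.1 hTm (hgraph π hπ)
  · exact ae_of_ae_map (measurable_id.prodMk hT').aemeasurable (hgraph _ hopt)

/-! ### Verification of the hypotheses in `ℝ^d`. -/

namespace SemiDiscreteProblem

variable {d : ℕ} (S : SemiDiscreteProblem d)

instance : IsProbabilityMeasure S.μ :=
  ⟨by rw [μ, densityMeasure, withDensity_apply _ .univ, setLIntegral_univ, S.density_mass]⟩

instance : IsProbabilityMeasure S.ν :=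
  inferInstanceAs (IsProbabilityMeasure S.targetMass.toMeasure)

lemma ae_mem_A : ∀ᵐ x : S.X ∂S.μ, (x : Fin d → ℝ) ∈ S.A := by
  have h : S.μ (S.μ.support)ᶜ = 0 := Measure.measure_compl_support
  exact measure_mono_null (Set.compl_subset_compl.2 S.support_subset) h

lemma measure_cost_sub_eq_const (hd : 2 ≤ d) {p : ℝ} (hp : 1 < p) {a b : S.Y} (hab : a ≠ b)
    (k : ℝ) : S.μ {x | S.cost p x a - S.cost p x b = k} = 0 := by
  refine withDensity_absolutelyContinuous _ _ ?_
  rw [lebesgueOn, comap_subtype_coe_apply S.measurableSet_X]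
  refine measure_mono_null ?_ (volume_pNormCost_sub_eq_const hd hp (Subtype.coe_ne_coe.2 hab) k)
  rintro _ ⟨x, hx, rfl⟩
  exact hx

lemma measurable_cost {p : ℝ} (hp : 1 < p) : Measurable fun z : S.X × S.Y => S.cost p z.1 z.2 := by
  have h : Measurable fun z : S.X × S.Y => ((z.1 : Fin d → ℝ), (z.2 : Fin d → ℝ)) :=
    (measurable_subtype_coe.comp measurable_fst).prodMk
      (measurable_subtype_coe.comp measurable_snd)
  have h' : Measurable fun z : (Fin d → ℝ) × (Fin d → ℝ) => pNormCost p z.1 z.2 :=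
    (continuous_pNormCost hp).measurable
  simpa only [cost, Function.comp_def] using h'.comp h

lemma exists_cost_bound {p : ℝ} (hp : 1 < p) :
    ∃ M : ℝ, ∀ᵐ x ∂S.μ, ∀ i, 0 ≤ S.cost p x (S.y i) ∧ S.cost p x (S.y i) ≤ M := by
  -- Almost every source point lies in the compact `A` and the targets are finitely many, so a
  -- continuous cost is bounded there.
  have hK : IsCompact (S.A ×ˢ Set.range fun i => (S.y i : Fin d → ℝ)) :=
    S.A_compact.prod (Set.finite_range _).isCompact
  obtain ⟨M, hM⟩ := hK.bddAbove_image (continuous_pNormCost hp).continuousOn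
  refine ⟨M, ?_⟩
  filter_upwards [S.ae_mem_A] with x hx i
  exact ⟨pNormCost_nonneg _ _ _, hM ⟨(x, S.y i), ⟨hx, i, rfl⟩, rfl⟩⟩

lemma ν_singleton_ne_zero (i : Fin S.n) : S.ν {S.y i} ≠ 0 := by
  rw [ν, PMF.toMeasure_apply_singleton _ _ (measurableSet_singleton _)]
  exact (PMF.mem_support_iff _ _).1 (by rw [S.targetMass_support]; exact ⟨i, rfl⟩)

lemma ν_compl_range : S.ν (Set.range S.y)ᶜ = 0 := by
  rw [ν, PMF.toMeasure_apply_eq_zero_iff _ (Set.finite_range _).measurableSet.compl,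
    S.targetMass_support]
  exact disjoint_compl_right

end SemiDiscreteProblem

theorem mainTheorem3 {d : ℕ} (hd : 2 ≤ d) (S : SemiDiscreteProblem d) (p : ℝ) (hp : 1 < p) :
    (∀ i j : Fin S.n, i ≠ j → ∀ k : ℝ,
      S.μ {x : S.X | (x : Fin d → ℝ) ∈ S.A ∧ S.cost p x (S.y i) - S.cost p x (S.y j) = k} = 0) ∧
    ∃ T : S.X → S.Y, Measurable T ∧
      IsOptimalPlan (S.cost p) S.μ S.ν (planOfMap S.μ T) ∧
      (∀ π : Measure (S.X × S.Y), IsOptimalPlan (S.cost p) S.μ S.ν π → π = planOfMap S.μ T) ∧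
      (∀ T' : S.X → S.Y, Measurable T' →
        IsOptimalPlan (S.cost p) S.μ S.ν (planOfMap S.μ T') → T' =ᵐ[S.μ] T) := by
  have htie : ∀ i j : Fin S.n, i ≠ j → ∀ k : ℝ,
      S.μ {x | S.cost p x (S.y i) - S.cost p x (S.y j) = k} = 0 := fun i j hij k =>
    S.measure_cost_sub_eq_const hd hp (S.y_injective.ne hij) k
  refine ⟨fun i j hij k => measure_mono_null (fun x hx => hx.2) (htie i j hij k), ?_⟩
  have : Nonempty (Fin S.n) := ⟨⟨0, by have := S.two_le_n; omega⟩⟩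
  obtain ⟨M, hM⟩ := S.exists_cost_bound hp
  exact exists_unique_optimal_map (S.measurable_cost hp) S.y_injective S.ν_compl_range
    S.ν_singleton_ne_zero hM htie
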